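/- Let $\mathcal X,\mathcal Y,\mathcal Z$ be finite sets and let $p_{XYZ}$ be a probability mass function (pmf) on $\mathcal X\times\mathcal Y\times\mathcal Z$. Alice, Bob and Eve observe $X^n$, $Y^n$ and $Z^n$, respectively, where $(X_i,Y_i,Z_i)$, $i=1,\dots,n$, are i.i.d. with pmf $p_{XYZ}$. A key agreement protocol consists of a finite number $k$ of rounds of public discussion and of key generation, with finite alphabets: Alice draws $F_1$ according to some $p_{F_1|X^n}$, Bob draws $F_2$ according to some $p_{F_2|Y^nF_1}$, Alice draws $F_3$ according to some $p_{F_3|X^nF_{1:2}}$, and so on; after $k$ rounds Alice draws a key $K_A$ according to some $p_{K_A|X^nF_{1:k}}$ and Bob draws a key $K_B$ according to some $p_{K_B|Y^nF_{1:k}}$, both with values in a finite set $\mathcal K$. The protocol is an $(n,\delta)$ code if \[ \mathbb P(K_A=K_B)\ge 1-\delta,\qquad \tfrac1n H(K_A)\ge \tfrac1n\log|\mathcal K|-\delta,\qquad \tfrac1n I(K_A;Z^nF_{1:k})\le\delta , \] and its key rate is $\frac1n H(K_A)$. A number $R$ is an achievable key rate if for every $\delta>0$ there are $n\ge 1$ and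 an $(n,\delta)$ code with key rate $R$. The secret-key (SK) capacity $S(X;Y\|Z)$ under $p_{XYZ}$ is the supremum of all achievable key rates. Theorem 3. Let $p_{XY}$ and $q_{XY}$ be two pmfs on $\mathcal X\times\mathcal Y$ such that there are functions $a:\mathcal X\to[0,\infty)$ and $b:\mathcal Y\to[0,\infty)$ with \[ q_{XY}(x,y)=a(x)\,b(y)\,p_{XY}(x,y)\qquad\text{for all }(x,y)\in\mathcal X\times\mathcal Y . \] Let $p_{Z|XY}$ be a channel from $\mathcal X\times\mathcal Y$ to $\mathcal Z$, and let $p_{XYZ}(x,y,z)=p_{XY}(x,y)\,p_{Z|XY}(z|x,y)$ and $q_{XYZ}(x,y,z)=q_{XY}(x,y)\,p_{Z|XY}(z|x,y)$. If the SK capacity $S(X;Y\|Z)$ under $q_{XYZ}$ is positive, then the SK capacity $S(X;Y\|Z)$ under $p_{XYZ}$ is also positive. -/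

import Mathlib

open scoped BigOperators ENNReal NNReal

noncomputable section

namespace SKAgreement

variable {X Y Z : Type*}

/-- `q ≼ p`: there are nonnegative functions `a`, `b` with `q(x,y) = a(x) b(y) p(x,y)`
for all `(x,y)`. -/
def Preceq (q p : PMF (X × Y)) : Prop :=
  ∃ (a : X → ℝ≥0) (b : Y → ℝ≥0), ∀ (x : X) (y : Y), q (x, y) = a x * b y * p (x, y)

/-- The source `p(x,y,z) = p(x,y) W(z|x,y)` obtained by passing `(X,Y)` through the channel `W`. -/
def source (p : PMF (X × Y)) (W : X × Y → PMF Z) : PMF (X × Y × Z) :=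
  p.bind fun xy => (W xy).map fun z => (xy.1, xy.2, z)

/-- Shannon entropy (in nats) of a pmf on a finite set. -/
def entropy {α : Type*} [Fintype α] (μ : α → ℝ) : ℝ :=
  ∑ a, Real.negMulLog (μ a)

/-- Mutual information `I(U;V) = H(U) + H(V) - H(U,V)` (in nats) of a joint pmf of `(U,V)`. -/
def mutualInfo {α β : Type*} [Fintype α] [Fintype β] (μ : α × β → ℝ) : ℝ :=
  entropy (fun a => ∑ b, μ (a, b)) + entropy (fun b => ∑ a, μ (a, b)) - entropy μ

/-- A key agreement protocol by interactive public discussion, for parties who see `X^n` and `Y^n`.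
Messages are numbered `0, 1, …, rounds - 1`. Message `i` is drawn by Alice from
`alice i x^n f_{<i}` if `i` is even, and by Bob from `bob i y^n f_{<i}` if `i` is odd (`alice i` for
odd `i`, `bob i` for even `i`, and all data with `i ≥ rounds` are not used). Then
Alice and Bob draw their keys, from `keyA x^n f` and `keyB y^n f`. -/
structure Protocol (X Y : Type*) (n : ℕ) where
  /-- number of rounds of communication -/
  rounds : ℕ
  /-- the finite alphabet of the `i`-th message -/
  Msg : ℕ → Type
  [fintypeMsg : ∀ i, Fintype (Msg i)]
  /-- the common finite alphabet of the two keys -/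
  Key : Type
  [fintypeKey : Fintype Key]
  alice : ∀ i : ℕ, (Fin n → X) → ((j : Fin i) → Msg j) → PMF (Msg i)
  bob : ∀ i : ℕ, (Fin n → Y) → ((j : Fin i) → Msg j) → PMF (Msg i)
  keyA : (Fin n → X) → ((j : Fin rounds) → Msg j) → PMF Key
  keyB : (Fin n → Y) → ((j : Fin rounds) → Msg j) → PMF Key

namespace Protocol

variable {n : ℕ}

attribute [instance] Protocol.fintypeMsg Protocol.fintypeKey

/-- The values of the whole public discussion. -/
abbrev Transcript (P : Protocol X Y n) : Type := (i : Fin P.rounds) → P.Msg i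

/-- `p(f_i | x^n, y^n, f_{<i})`: the probability that message `i` equals `f i`, given the
observations and the earlier messages. -/
def msgProb (P : Protocol X Y n) (x : Fin n → X) (y : Fin n → Y) (f : P.Transcript)
    (i : Fin P.rounds) : ℝ :=
  if Even (i : ℕ) then
    (P.alice i x (fun j => f ⟨j, j.2.trans i.2⟩) (f i)).toReal
  else
    (P.bob i y (fun j => f ⟨j, j.2.trans i.2⟩) (f i)).toReal

/-- The joint pmf of `(X^n, Y^n, Z^n, F, K_A, K_B)` when `(X_i, Y_i, Z_i)` are i.i.d. with pmf `p`
and the protocol is run on `X^n` and `Y^n`. -/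
def law (P : Protocol X Y n) (p : PMF (X × Y × Z)) (x : Fin n → X) (y : Fin n → Y)
    (z : Fin n → Z) (f : P.Transcript) (kA kB : P.Key) : ℝ :=
  (∏ i, (p (x i, y i, z i)).toReal) * (∏ i, P.msgProb x y f i) *
    (P.keyA x f kA).toReal * (P.keyB y f kB).toReal

variable [Fintype X] [Fintype Y] [Fintype Z]

/-- `ℙ(K_A = K_B)`. -/
def agreeProb (P : Protocol X Y n) (p : PMF (X × Y × Z)) : ℝ :=
  ∑ x, ∑ y, ∑ z, ∑ f, ∑ k, P.law p x y z f k k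

/-- The pmf of `K_A`. -/
def keyLaw (P : Protocol X Y n) (p : PMF (X × Y × Z)) (kA : P.Key) : ℝ :=
  ∑ x, ∑ y, ∑ z, ∑ f, ∑ kB, P.law p x y z f kA kB

/-- The joint pmf of `K_A` and Eve's information `(Z^n, F)`. -/
def keyEveLaw (P : Protocol X Y n) (p : PMF (X × Y × Z))
    (o : P.Key × ((Fin n → Z) × P.Transcript)) : ℝ :=
  ∑ x, ∑ y, ∑ kB, P.law p x y o.2.1 o.2.2 o.1 kB

/-- The protocol is an `(n, δ)` code for the source `p`: the keys agree with probability at least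
`1 - δ`, the key is nearly uniform, and it is nearly independent of Eve's information. -/
structure IsCode (P : Protocol X Y n) (p : PMF (X × Y × Z)) (δ : ℝ) : Prop where
  agree : 1 - δ ≤ P.agreeProb p
  uniform : 1 / (n : ℝ) * Real.log (Fintype.card P.Key) - δ ≤ 1 / (n : ℝ) * entropy (P.keyLaw p)
  secret : 1 / (n : ℝ) * mutualInfo (P.keyEveLaw p) ≤ δ

end Protocol

variable [Fintype X] [Fintype Y] [Fintype Z]

/-- `R` is an achievable key rate for the source `p`: for every `δ > 0` there is an `(n, δ)` code
whose key rate `H(K_A) / n` is `R`. -/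
def IsAchievable (p : PMF (X × Y × Z)) (R : ℝ) : Prop :=
  ∀ δ : ℝ, 0 < δ → ∃ n : ℕ, 0 < n ∧ ∃ P : Protocol X Y n,
    P.IsCode p δ ∧ 1 / (n : ℝ) * entropy (P.keyLaw p) = R

/-- The secret-key capacity `S(X;Y‖Z)` of the source `p`: the supremum of all achievable rates. -/
def skCapacity (p : PMF (X × Y × Z)) : EReal :=
  ⨆ (R : ℝ) (_ : IsAchievable p R), (R : EReal)

end SKAgreement

end

noncomputable section

namespace SKAgreement

set_option linter.unusedSectionVars false

/-! ### Pmfs on finite types -/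

/-! Let Alice keep a symbol `x` with probability proportional to `a x`, and Bob keep `y` with
probability proportional to `b y`, both announcing their decisions. A triple kept by both has law
proportional to `a x * b y * p(x,y,z)`, hence exactly `q(x,y,z)`, and the kept triples are
independent. A code for `q` run on them is therefore a code for `p` (`exists_tests`,
`Protocol.sifted`). Each symbol is kept with a fixed probability `c > 0`, so the rate drops only by
a constant factor.

Two points need care. A code for `q` may be so short that having too few kept symbols is not
unlikely; running many copies in parallel cures this (`agreeProb_parallel`, `mutualInfo_parallel`,
`entropy_keyLaw_parallel`, `one_sub_successProb_le`). Moreover an achievable rate must be attained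
exactly by every code, so on failure Alice draws a fresh key from the law the key has under `q`.
Then the key law does not change (`keyLaw_sifted`), and the leaked information is the original one
times the success probability (`mutualInfo_sifted`). `isAchievable_of_tests` combines these facts.
-/

theorem sum_toReal_eq_one {α : Type*} [Fintype α] (p : PMF α) : ∑ a, (p a).toReal = 1 := by
  rw [← ENNReal.toReal_sum fun a _ => p.apply_ne_top a, ← tsum_fintype (L := .unconditional _),
    p.tsum_coe, ENNReal.toReal_one]

/-- The law of independent random variables with laws `p i`. -/
def piPMF {ι : Type*} {α : ι → Type*} [Fintype ι] [DecidableEq ι] [∀ i, Fintype (α i)]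
    (p : ∀ i, PMF (α i)) : PMF (∀ i, α i) :=
  PMF.ofFintype (fun f => ∏ i, p i (f i)) <| by
    rw [← Fintype.piFinset_univ, ← Finset.prod_univ_sum]
    refine Finset.prod_eq_one fun i _ => ?_
    rw [← tsum_fintype (L := .unconditional _), (p i).tsum_coe]

theorem piPMF_toReal {ι : Type*} {α : ι → Type*} [Fintype ι] [DecidableEq ι]
    [∀ i, Fintype (α i)] (p : ∀ i, PMF (α i)) (f : ∀ i, α i) :
    (piPMF p f).toReal = ∏ i, (p i (f i)).toReal := by
  simp [piPMF, PMF.ofFintype_apply, ENNReal.toReal_prod]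

/-- A sequence of draws, each of which depends on the previous ones, has total mass one. -/
theorem sum_prod_kernels_eq_one (M : ℕ → Type*) [∀ i, Fintype (M i)]
    (g : ∀ i, ((j : Fin i) → M j) → M i → ℝ) (hg : ∀ i h, ∑ a, g i h a = 1) (r : ℕ) :
    ∑ f : (i : Fin r) → M i, ∏ i : Fin r, g i (fun j => f ⟨j, j.2.trans i.2⟩) (f i) = 1 := by
  induction r with
  | zero => simp
  | succ r ih =>
    rw [← (Fin.snocEquiv fun i : Fin (r + 1) => M i).sum_comp, Fintype.sum_prod_type_right, ← ih]
    refine Fintype.sum_congr _ _ fun f => ?_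
    simp only [Fin.prod_univ_castSucc, Fin.snocEquiv_apply, Fin.snoc_last, Fin.snoc_castSucc]
    -- The last message occurs neither in the histories of the earlier ones (`h1`) nor in its own
    -- (`h2`), so it can be summed out first.
    have h1 : ∀ (a : M r) (i : Fin r),
        (fun j : Fin (i.castSucc : Fin (r + 1)) =>
          (Fin.snoc (α := fun i : Fin (r + 1) => M i) f a ⟨j, j.2.trans i.castSucc.2⟩ : M j))
          = fun j : Fin i => f ⟨j, j.2.trans i.2⟩ := fun a i => funext fun j =>
      Fin.snoc_castSucc (α := fun i : Fin (r + 1) => M i) a f ⟨j, j.2.trans i.2⟩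
    have h2 : ∀ a : M r,
        (fun j : Fin (Fin.last r : Fin (r + 1)) =>
          (Fin.snoc (α := fun i : Fin (r + 1) => M i) f a ⟨j, j.2.trans (Fin.last r).2⟩ : M j))
          = fun j : Fin r => f j := fun a => funext fun j =>
      Fin.snoc_castSucc (α := fun i : Fin (r + 1) => M i) a f j
    have h3 : ∀ a : M r, ∏ i : Fin r, g (i.castSucc : Fin (r + 1))
        (fun j : Fin (i.castSucc : Fin (r + 1)) =>
          (Fin.snoc (α := fun i : Fin (r + 1) => M i) f a ⟨j, j.2.trans i.castSucc.2⟩ : M j)) (f i)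
          = ∏ i : Fin r, g i (fun j => f ⟨j, j.2.trans i.2⟩) (f i) := fun a =>
      Finset.prod_congr rfl fun i _ => congrArg (fun h => g i h (f i)) (h1 a i)
    calc _ = ∑ a : M r, (∏ i : Fin r, g i (fun j => f ⟨j, j.2.trans i.2⟩) (f i)) *
          g r (fun j : Fin r => f j) a := by
          refine Fintype.sum_congr _ _ fun a => ?_
          exact congrArg₂ (· * ·) (h3 a) (congrArg (fun h => g r h a) (h2 a))
      _ = _ := by rw [← Finset.mul_sum, hg, mul_one]

theorem sum_prod_pi {ι α : Type*} [Fintype ι] [DecidableEq ι] [Fintype α] (g : ι → α → ℝ) :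
    ∑ f : ι → α, ∏ j, g j (f j) = ∏ j, ∑ a, g j a := by
  rw [Finset.prod_univ_sum, Fintype.piFinset_univ]

/-- The index type of a sequence as the range of an embedding and its complement. -/
def sumComplRange {ι κ : Type*} (e : κ ↪ ι) : κ ⊕ {i // i ∉ Set.range e} ≃ ι :=
  open Classical in
  ((Equiv.ofInjective e e.injective).sumCongr (Equiv.refl _)).trans
    (Equiv.sumCompl (· ∈ Set.range e))

theorem prod_eq_prod_mul_prod_compl_range {ι κ : Type*} [Fintype ι] [Fintype κ] (e : κ ↪ ι)
    [Fintype {i // i ∉ Set.range e}] (h : ι → ℝ) : ∏ i, h i = (∏ j, h (e j)) * ∏ i : {i // i ∉ Set.range e}, h i := by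
  rw [← (sumComplRange e).prod_comp, Fintype.prod_sum_type]
  rfl

/-- Summing a product weight against a function of the coordinates in the range of `e`. -/
theorem sum_comp_mul_prod {ι κ T : Type*} [Fintype ι] [Fintype κ] [Fintype T]
    [DecidableEq ι] [DecidableEq κ] (e : κ ↪ ι) [Fintype {i // i ∉ Set.range e}]
    (F : (κ → T) → ℝ) (w : ι → T → ℝ) :
    ∑ t : ι → T, F (t ∘ e) * ∏ i, w i (t i) =
      (∑ t : κ → T, F t * ∏ j, w (e j) (t j)) *
        ∏ i : {i // i ∉ Set.range e}, ∑ a, w i a := by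
  classical
  let E := sumComplRange e
  let G : (κ → T) × ({i // i ∉ Set.range e} → T) ≃ (ι → T) :=
    (Equiv.sumArrowEquivProdArrow _ _ _).symm.trans (E.arrowCongr (Equiv.refl T))
  have hG : ∀ u a, G u (E a) = Sum.elim u.1 u.2 a := fun u a => by
    simp only [G, Equiv.trans_apply, Equiv.arrowCongr_apply, Function.comp_apply,
      Equiv.symm_apply_apply]
    rfl
  have hGl : ∀ u j, G u (e j) = u.1 j := fun u j => hG u (Sum.inl j)
  have hGr : ∀ u (i : {i // i ∉ Set.range e}), G u i = u.2 i := fun u i => hG u (Sum.inr i)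
  rw [← G.sum_comp, Fintype.sum_prod_type, Finset.sum_mul]
  refine Fintype.sum_congr _ _ fun t => ?_
  rw [← sum_prod_pi, Finset.mul_sum]
  refine Fintype.sum_congr _ _ fun v => ?_
  rw [prod_eq_prod_mul_prod_compl_range e, ← mul_assoc]
  have : G (t, v) ∘ e = t := funext fun j => hGl _ j
  simp only [this, hGl, hGr]

/-! ### Entropy -/

theorem entropy_equiv {α β : Type*} [Fintype α] [Fintype β] (e : α ≃ β) (μ : β → ℝ) :
    entropy (fun a => μ (e a)) = entropy μ :=
  e.sum_comp fun b => Real.negMulLog (μ b)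

/-- The product rule of `Real.negMulLog` splits off one factor, and total mass one sums away the
rest. The rule holds for all reals, so zero masses need no separate case. -/
theorem entropy_pi {α : Type*} [Fintype α] (μ : α → ℝ) (hμ : ∑ a, μ a = 1) (m : ℕ) :
    entropy (fun f : Fin m → α => ∏ j, μ (f j)) = m * entropy μ := by
  induction m with
  | zero => simp [entropy]
  | succ m ih =>
    have key : entropy (fun f : Fin (m + 1) → α => ∏ j, μ (f j)) =
        ∑ a, ∑ f : Fin m → α, ((∏ j, μ (f j)) * Real.negMulLog (μ a) +
          μ a * Real.negMulLog (∏ j, μ (f j))) := by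
      rw [entropy, ← (Fin.consEquiv fun _ : Fin (m + 1) => α).sum_comp, Fintype.sum_prod_type]
      refine Fintype.sum_congr _ _ fun a => Fintype.sum_congr _ _ fun f => ?_
      rw [Fin.prod_univ_succ]
      simp [Fin.consEquiv, Real.negMulLog_mul]
    have h2 : ∑ f : Fin m → α, Real.negMulLog (∏ j, μ (f j)) = m * entropy μ := ih
    rw [key]
    simp only [Finset.sum_add_distrib, ← Finset.mul_sum, ← Finset.sum_mul, sum_prod_pi, hμ, h2,
      Finset.prod_const_one]
    rw [entropy]
    push_cast
    simp
    ring

/-- The conditional entropy of one column of a joint pmf, weighted by the mass of the column. -/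
def columnEntropy {κ : Type*} [Fintype κ] (v : κ → ℝ) : ℝ :=
  entropy v - Real.negMulLog (∑ k, v k)

/-- The two `Real.negMulLog c` terms cancel. This homogeneity is what makes rescaled columns of a
joint law easy to sum. -/
theorem columnEntropy_mul {κ : Type*} [Fintype κ] (c : ℝ) (v : κ → ℝ) :
    columnEntropy (fun k => c * v k) = c * columnEntropy v := by
  simp only [columnEntropy, entropy, ← Finset.mul_sum, Real.negMulLog_mul,
    Finset.sum_add_distrib, ← Finset.sum_mul]
  ring

theorem columnEntropy_eq_entropy {κ : Type*} [Fintype κ] (v : κ → ℝ) (hv : ∑ k, v k = 1) :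
    columnEntropy v = entropy v := by
  simp [columnEntropy, hv]

theorem mutualInfo_eq_sub {κ β : Type*} [Fintype κ] [Fintype β] (μ : κ × β → ℝ) :
    mutualInfo μ = entropy (fun k => ∑ o, μ (k, o)) -
      ∑ o, columnEntropy (fun k => μ (k, o)) := by
  simp only [mutualInfo, columnEntropy, entropy, Fintype.sum_prod_type_right,
    Finset.sum_sub_distrib]
  ring

theorem mutualInfo_pi {κ β γ : Type*} [Fintype κ] [Fintype β] [Fintype γ] (μ : κ × β → ℝ)
    (hμ : ∑ a, μ a = 1) (m : ℕ) (E : γ ≃ (Fin m → β)) :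
    mutualInfo (fun o : (Fin m → κ) × γ => ∏ j, μ (o.1 j, E o.2 j)) = m * mutualInfo μ := by
  have h1 : (fun k : Fin m → κ => ∑ o : γ, ∏ j, μ (k j, E o j)) =
      fun k => ∏ j, (fun a => ∑ o, μ (a, o)) (k j) := by
    funext k
    rw [E.sum_comp fun o => ∏ j, μ (k j, o j), sum_prod_pi fun j o => μ (k j, o)]
  have h2 : (fun o : γ => ∑ k : Fin m → κ, ∏ j, μ (k j, E o j)) =
      fun o => (fun o' : Fin m → β => ∏ j, (fun b => ∑ k, μ (k, b)) (o' j)) (E o) := by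
    funext o
    exact sum_prod_pi fun j k => μ (k, E o j)
  have h3 : entropy (fun o : (Fin m → κ) × γ => ∏ j, μ (o.1 j, E o.2 j)) =
      entropy (fun f : Fin m → κ × β => ∏ j, μ (f j)) :=
    entropy_equiv (((Equiv.refl _).prodCongr E).trans
      (Equiv.arrowProdEquivProdArrow (Fin m) (fun _ => κ) (fun _ => β)).symm)
      (fun f : Fin m → κ × β => ∏ j, μ (f j))
  have s1 : ∑ a, ∑ o, μ (a, o) = 1 := by rw [← Fintype.sum_prod_type, hμ]
  have s2 : ∑ b, ∑ k, μ (k, b) = 1 := by rw [← Fintype.sum_prod_type_right, hμ]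
  rw [mutualInfo, h3, h1, h2,
    entropy_equiv E fun o' : Fin m → β => ∏ j, (fun b => ∑ k, μ (k, b)) (o' j), entropy_pi _ s1, entropy_pi _ s2, entropy_pi _ hμ,
    mutualInfo]
  ring

theorem sum_prod_pi_equiv {ι α γ : Type*} [Fintype ι] [DecidableEq ι] [Fintype α] [Fintype γ]
    (E : γ ≃ (ι → α)) (g : ι → α → ℝ) :
    ∑ c, ∏ j, g j (E c j) = ∏ j, ∑ a, g j a := by
  rw [E.sum_comp fun f => ∏ j, g j (f j), sum_prod_pi]

/-- Summing over three sequences is summing over a sequence of triples. -/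
theorem sum_triple {ι X Y Z : Type*} [Fintype ι] [DecidableEq ι] [Fintype X] [Fintype Y]
    [Fintype Z] (w : ι → X → Y → Z → ℝ) :
    ∑ x : ι → X, ∑ y : ι → Y, ∑ z : ι → Z, ∏ i, w i (x i) (y i) (z i) =
      ∏ i, ∑ x, ∑ y, ∑ z, w i x y z := by
  have h1 : ∀ (x : ι → X) (y : ι → Y), ∑ z : ι → Z, ∏ i, w i (x i) (y i) (z i) =
      ∏ i, ∑ z, w i (x i) (y i) z := fun x y => sum_prod_pi fun i z => w i (x i) (y i) z
  have h2 : ∀ x : ι → X, ∑ y : ι → Y, ∏ i, ∑ z, w i (x i) (y i) z =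
      ∏ i, ∑ y, ∑ z, w i (x i) y z := fun x => sum_prod_pi fun i y => ∑ z, w i (x i) y z
  simp only [h1, h2]
  exact sum_prod_pi fun i x => ∑ y, ∑ z, w i x y z

theorem sum_pmf_triple {X Y Z : Type*} [Fintype X] [Fintype Y] [Fintype Z]
    (p : PMF (X × Y × Z)) : ∑ x, ∑ y, ∑ z, (p (x, y, z)).toReal = 1 := by
  rw [← sum_toReal_eq_one p, Fintype.sum_prod_type]
  simp only [Fintype.sum_prod_type]

/-! ### Total mass and positivity of the law of a protocol -/

namespace Protocol

variable {X Y Z : Type*} {n : ℕ}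

theorem sum_prod_msgProb (P : Protocol X Y n) (x : Fin n → X) (y : Fin n → Y) :
    ∑ f, ∏ i, P.msgProb x y f i = 1 :=
  sum_prod_kernels_eq_one P.Msg (fun i h a =>
    if Even i then (P.alice i x h a).toReal else (P.bob i y h a).toReal) (fun i h => by
      split_ifs
      · exact sum_toReal_eq_one _
      · exact sum_toReal_eq_one _) P.rounds

theorem law_nonneg (P : Protocol X Y n) (p : PMF (X × Y × Z)) (x y z f kA kB) :
    0 ≤ P.law p x y z f kA kB := by
  have : ∀ i, 0 ≤ P.msgProb x y f i := fun i => by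
    unfold msgProb
    split_ifs <;> exact ENNReal.toReal_nonneg
  have h := Finset.prod_nonneg (s := Finset.univ) fun i _ => this i
  unfold law
  positivity

/-! ### Parallel repetition -/

/-- A sequence of length `m * n` as `m` blocks of length `n`. -/
def blocks (m n : ℕ) (X : Type*) : (Fin (m * n) → X) ≃ (Fin m → Fin n → X) :=
  (finProdFinEquiv.symm.arrowCongr (Equiv.refl X)).trans (Equiv.curry _ _ _)

theorem prod_blocks (m n : ℕ) (w : Fin (m * n) → ℝ) :
    ∏ i, w i = ∏ j, ∏ i, w (finProdFinEquiv (j, i)) := by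
  rw [← finProdFinEquiv.prod_comp, Fintype.prod_prod_type]

/-- The protocol that runs `P` independently on `m` blocks, in parallel. -/
def parallel (P : Protocol X Y n) (m : ℕ) : Protocol X Y (m * n) where
  rounds := P.rounds
  Msg i := Fin m → P.Msg i
  Key := Fin m → P.Key
  alice i x f := piPMF fun j => P.alice i (blocks m n X x j) fun l => f l j
  bob i y f := piPMF fun j => P.bob i (blocks m n Y y j) fun l => f l j
  keyA x f := piPMF fun j => P.keyA (blocks m n X x j) fun l => f l j
  keyB y f := piPMF fun j => P.keyB (blocks m n Y y j) fun l => f l j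

/-- The transcripts of the copies of `P`. -/
def parallelTranscript (P : Protocol X Y n) (m : ℕ) :
    (P.parallel m).Transcript ≃ (Fin m → P.Transcript) :=
  Equiv.piComm fun (i : Fin P.rounds) (_ : Fin m) => P.Msg i

/-- All copies send their `i`-th message in the same round, so the turns are preserved and every
factor of the law splits over the blocks. -/
theorem law_parallel (P : Protocol X Y n) (p : PMF (X × Y × Z)) (m : ℕ) (x y z f)
    (kA kB : Fin m → P.Key) :
    (P.parallel m).law p x y z f kA kB =
      ∏ j, P.law p (blocks m n X x j) (blocks m n Y y j) (blocks m n Z z j)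
        (P.parallelTranscript m f j) (kA j) (kB j) := by
  have h1 : ∏ i, (P.parallel m).msgProb x y f i = ∏ j, ∏ i : Fin P.rounds,
      P.msgProb (blocks m n X x j) (blocks m n Y y j) (P.parallelTranscript m f j) i := by
    rw [Finset.prod_comm]
    refine Finset.prod_congr rfl fun i _ => ?_
    simp only [msgProb]
    split_ifs
    · exact piPMF_toReal _ _
    · exact piPMF_toReal _ _
  have h2 : ((P.parallel m).keyA x f kA).toReal =
      ∏ j, (P.keyA (blocks m n X x j) (P.parallelTranscript m f j) (kA j)).toReal :=
    piPMF_toReal _ _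
  have h3 : ((P.parallel m).keyB y f kB).toReal =
      ∏ j, (P.keyB (blocks m n Y y j) (P.parallelTranscript m f j) (kB j)).toReal :=
    piPMF_toReal _ _
  simp only [law, Finset.prod_mul_distrib]
  rw [h1, h2, h3, prod_blocks]
  rfl

variable [Fintype X] [Fintype Y] [Fintype Z]

theorem sum_keyEveLaw (P : Protocol X Y n) (p : PMF (X × Y × Z)) (k : P.Key) :
    ∑ o, P.keyEveLaw p (k, o) = P.keyLaw p k := by
  simp only [keyEveLaw, keyLaw]
  rw [Finset.sum_comm]
  refine Fintype.sum_congr _ _ fun x => ?_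
  rw [Finset.sum_comm]
  refine Fintype.sum_congr _ _ fun y => ?_
  rw [Fintype.sum_prod_type]

theorem sum_keyLaw (P : Protocol X Y n) (p : PMF (X × Y × Z)) : ∑ k, P.keyLaw p k = 1 := by
  have h : ∀ x y z f, ∑ kA, ∑ kB, P.law p x y z f kA kB =
      (∏ i, (p (x i, y i, z i)).toReal) * ∏ i, P.msgProb x y f i := by
    intro x y z f
    simp only [law, ← Finset.mul_sum, sum_toReal_eq_one, mul_one]
  calc ∑ k, P.keyLaw p k
      = ∑ x, ∑ y, ∑ z, ∑ f, ∑ kA, ∑ kB, P.law p x y z f kA kB := by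
        simp only [keyLaw]
        rw [Finset.sum_comm]; refine Fintype.sum_congr _ _ fun x => ?_
        rw [Finset.sum_comm]; refine Fintype.sum_congr _ _ fun y => ?_
        rw [Finset.sum_comm]; refine Fintype.sum_congr _ _ fun z => ?_
        rw [Finset.sum_comm]
    _ = 1 := by
        simp only [h, ← Finset.mul_sum, sum_prod_msgProb, mul_one]
        rw [sum_triple fun _ x y z => (p (x, y, z)).toReal]
        simp [sum_pmf_triple]

theorem keyLaw_nonneg (P : Protocol X Y n) (p : PMF (X × Y × Z)) (k) : 0 ≤ P.keyLaw p k := by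
  unfold keyLaw
  exact Finset.sum_nonneg fun x _ => Finset.sum_nonneg fun y _ => Finset.sum_nonneg fun z _ =>
    Finset.sum_nonneg fun f _ => Finset.sum_nonneg fun kB _ => P.law_nonneg p x y z f k kB

theorem agreeProb_nonneg (P : Protocol X Y n) (p : PMF (X × Y × Z)) : 0 ≤ P.agreeProb p := by
  unfold agreeProb
  exact Finset.sum_nonneg fun x _ => Finset.sum_nonneg fun y _ => Finset.sum_nonneg fun z _ =>
    Finset.sum_nonneg fun f _ => Finset.sum_nonneg fun k _ => P.law_nonneg p x y z f k k

theorem agreeProb_parallel (P : Protocol X Y n) (p : PMF (X × Y × Z)) (m : ℕ) :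
    (P.parallel m).agreeProb p = P.agreeProb p ^ m := by
  let L := P.law p
  -- The sums pass through the product over the copies one at a time, innermost first.
  have h1 : ∀ (x : Fin m → Fin n → X) (y : Fin m → Fin n → Y) (z : Fin m → Fin n → Z)
      (f : Fin m → P.Transcript),
      ∑ k : Fin m → P.Key, ∏ j, L (x j) (y j) (z j) (f j) (k j) (k j) =
        ∏ j, ∑ k, L (x j) (y j) (z j) (f j) k k :=
    fun x y z f => sum_prod_pi fun j k => L (x j) (y j) (z j) (f j) k k
  have h2 : ∀ (x : Fin m → Fin n → X) (y : Fin m → Fin n → Y) (z : Fin m → Fin n → Z),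
      ∑ f, ∏ j, ∑ k, L (x j) (y j) (z j) (P.parallelTranscript m f j) k k =
        ∏ j, ∑ f, ∑ k, L (x j) (y j) (z j) f k k :=
    fun x y z => sum_prod_pi_equiv _ fun j f => ∑ k, L (x j) (y j) (z j) f k k
  have h3 : ∀ (x : Fin m → Fin n → X) (y : Fin m → Fin n → Y),
      ∑ z, ∏ j, ∑ f, ∑ k, L (x j) (y j) (blocks m n Z z j) f k k =
        ∏ j, ∑ z, ∑ f, ∑ k, L (x j) (y j) z f k k :=
    fun x y => sum_prod_pi_equiv _ fun j z => ∑ f, ∑ k, L (x j) (y j) z f k k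
  have h4 : ∀ (x : Fin m → Fin n → X),
      ∑ y, ∏ j, ∑ z, ∑ f, ∑ k, L (x j) (blocks m n Y y j) z f k k =
        ∏ j, ∑ y, ∑ z, ∑ f, ∑ k, L (x j) y z f k k :=
    fun x => sum_prod_pi_equiv _ fun j y => ∑ z, ∑ f, ∑ k, L (x j) y z f k k
  have h5 : ∑ x, ∏ j, ∑ y, ∑ z, ∑ f, ∑ k, L (blocks m n X x j) y z f k k =
        ∏ _j : Fin m, ∑ x, ∑ y, ∑ z, ∑ f, ∑ k, L x y z f k k :=
    sum_prod_pi_equiv _ fun _ x => ∑ y, ∑ z, ∑ f, ∑ k, L x y z f k k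
  calc (P.parallel m).agreeProb p
      = ∑ x, ∑ y, ∑ z, ∑ f, ∑ k : Fin m → P.Key,
          ∏ j, L (blocks m n X x j) (blocks m n Y y j) (blocks m n Z z j)
            (P.parallelTranscript m f j) (k j) (k j) := by
        refine Fintype.sum_congr _ _ fun x => Fintype.sum_congr _ _ fun y =>
          Fintype.sum_congr _ _ fun z => Fintype.sum_congr _ _ fun f => ?_
        exact Fintype.sum_congr _ _ fun k => P.law_parallel p m x y z f k k
    _ = P.agreeProb p ^ m := by
        simp only [h1, h2, h3, h4, h5, Finset.prod_const, Finset.card_univ, Fintype.card_fin]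
        rfl

/-- Eve's view of the parallel runs, as the sequence of her views of the runs. -/
def parallelView (P : Protocol X Y n) (m : ℕ) (Z : Type*) :
    ((Fin (m * n) → Z) × (P.parallel m).Transcript) ≃
      (Fin m → (Fin n → Z) × P.Transcript) :=
  ((blocks m n Z).prodCongr (P.parallelTranscript m)).trans
    (Equiv.arrowProdEquivProdArrow (Fin m) (fun _ => Fin n → Z) (fun _ => P.Transcript)).symm

theorem keyEveLaw_parallel (P : Protocol X Y n) (p : PMF (X × Y × Z)) (m : ℕ) :
    (P.parallel m).keyEveLaw p = fun o : (Fin m → P.Key) × _ =>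
      ∏ j, P.keyEveLaw p (o.1 j, P.parallelView m Z o.2 j) := by
  funext ⟨k, z, f⟩
  let L := P.law p
  let z' := blocks m n Z z
  let f' := P.parallelTranscript m f
  have h1 : ∀ (x : Fin m → Fin n → X) (y : Fin m → Fin n → Y),
      ∑ kB : Fin m → P.Key, ∏ j, L (x j) (y j) (z' j) (f' j) (k j) (kB j) =
        ∏ j, ∑ kB, L (x j) (y j) (z' j) (f' j) (k j) kB :=
    fun x y => sum_prod_pi fun j kB => L (x j) (y j) (z' j) (f' j) (k j) kB
  have h2 : ∀ (x : Fin m → Fin n → X),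
      ∑ y, ∏ j, ∑ kB, L (x j) (blocks m n Y y j) (z' j) (f' j) (k j) kB =
        ∏ j, ∑ y, ∑ kB, L (x j) y (z' j) (f' j) (k j) kB :=
    fun x => sum_prod_pi_equiv _ fun j y => ∑ kB, L (x j) y (z' j) (f' j) (k j) kB
  have h3 : ∑ x, ∏ j, ∑ y, ∑ kB, L (blocks m n X x j) y (z' j) (f' j) (k j) kB =
        ∏ j, ∑ x, ∑ y, ∑ kB, L x y (z' j) (f' j) (k j) kB :=
    sum_prod_pi_equiv _ fun j x => ∑ y, ∑ kB, L x y (z' j) (f' j) (k j) kB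
  calc (P.parallel m).keyEveLaw p (k, z, f)
      = ∑ x, ∑ y, ∑ kB : Fin m → P.Key,
          ∏ j, L (blocks m n X x j) (blocks m n Y y j) (z' j) (f' j) (k j) (kB j) := by
        refine Fintype.sum_congr _ _ fun x => Fintype.sum_congr _ _ fun y => ?_
        exact Fintype.sum_congr _ _ fun kB => P.law_parallel p m x y z f k kB
    _ = _ := by
        simp only [h1, h2, h3]
        rfl

theorem sum_all_keyEveLaw (P : Protocol X Y n) (p : PMF (X × Y × Z)) :
    ∑ o, P.keyEveLaw p o = 1 := by
  rw [Fintype.sum_prod_type]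
  simp only [sum_keyEveLaw, sum_keyLaw]

theorem mutualInfo_parallel (P : Protocol X Y n) (p : PMF (X × Y × Z)) (m : ℕ) :
    mutualInfo ((P.parallel m).keyEveLaw p) = m * mutualInfo (P.keyEveLaw p) := by
  rw [keyEveLaw_parallel]
  exact mutualInfo_pi _ (P.sum_all_keyEveLaw p) m (P.parallelView m Z)

theorem entropy_keyLaw_parallel (P : Protocol X Y n) (p : PMF (X × Y × Z)) (m : ℕ) :
    entropy ((P.parallel m).keyLaw p) = m * entropy (P.keyLaw p) := by
  rw [← entropy_pi _ (P.sum_keyLaw p)]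
  congr 1
  funext k
  rw [← sum_keyEveLaw, keyEveLaw_parallel]
  refine (sum_prod_pi_equiv (P.parallelView m Z) fun j o => P.keyEveLaw p (k j, o)).trans ?_
  exact Finset.prod_congr rfl fun j _ => P.sum_keyEveLaw p (k j)

end Protocol

namespace Protocol

variable {X Y Z : Type*} {n : ℕ}

/-! ### Running a protocol on the symbols that both parties accept -/

/-- `n` positions at which both `s` and `t` are true, if there are so many. -/
def commonPositions (n : ℕ) {N : ℕ} (s t : Fin N → Bool) : Option (Fin n ↪ Fin N) :=
  open Classical in
  if h : ∃ e : Fin n ↪ Fin N, ∀ j, s (e j) = true ∧ t (e j) = true then some h.choose else none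

theorem commonPositions_spec {N : ℕ} {s t : Fin N → Bool} {e : Fin n ↪ Fin N}
    (h : commonPositions n s t = some e) (j : Fin n) : s (e j) = true ∧ t (e j) = true := by
  unfold commonPositions at h
  split_ifs at h with h'
  cases h
  exact h'.choose_spec j

theorem card_lt_of_commonPositions_eq_none {N : ℕ} {s t : Fin N → Bool}
    (h : commonPositions n s t = none) :
    (Finset.univ.filter fun i => s i = true ∧ t i = true).card < n := by
  unfold commonPositions at h
  split_ifs at h with h'
  by_contra! hn
  obtain ⟨u, hu, hcard⟩ := Finset.exists_subset_card_eq hn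
  refine h' ⟨(u.orderEmbOfFin hcard).toEmbedding, fun j => ?_⟩
  simpa using hu (Finset.orderEmbOfFin_mem u hcard j)

/-- The subsequence of `x` at the positions `e`, or `x₀` if there are no positions. -/
def subsequence {N : ℕ} (x₀ : Fin n → X) (e : Option (Fin n ↪ Fin N)) (x : Fin N → X) :
    Fin n → X :=
  e.elim x₀ fun e => x ∘ e

/-- The alphabets of two messages with values in `A`, followed by the alphabets `M`. -/
def siftedMsg (A : Type) (M : ℕ → Type) : ℕ → Type
  | 0 => A
  | 1 => A
  | i + 2 => M i

instance siftedMsg.fintype (A : Type) (M : ℕ → Type) [Fintype A] [∀ i, Fintype (M i)] :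
    ∀ i, Fintype (siftedMsg A M i)
  | 0 => inferInstanceAs (Fintype A)
  | 1 => inferInstanceAs (Fintype A)
  | i + 2 => inferInstanceAs (Fintype (M i))

/-- Alice and Bob accept each of `N` symbols according to the tests `α` and `β`, announce which
symbols they accept, and run `P` on `n` symbols which both accept. If there are fewer of these, they
run `P` on `x₀` and `y₀`, but Alice draws her key from `κ`. -/
def sifted (P : Protocol X Y n) (N : ℕ) (α : X → PMF Bool) (β : Y → PMF Bool) (x₀ : Fin n → X)
    (y₀ : Fin n → Y) (κ : PMF P.Key) : Protocol X Y N where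
  rounds := P.rounds + 2
  Msg := siftedMsg (Fin N → Bool) P.Msg
  Key := P.Key
  alice
    | 0 => fun x _ => piPMF fun i => α (x i)
    -- It is Bob's turn in round `1` and Alice's in round `0`; the other party's kernel there is a
    -- dummy.
    | 1 => fun _ _ => PMF.pure fun _ => false
    | i + 2 => fun x f =>
      P.alice i (subsequence x₀ (commonPositions n (f ⟨0, by omega⟩) (f ⟨1, by omega⟩)) x)
        fun j => f ⟨j + 2, by omega⟩
  bob
    | 0 => fun _ _ => PMF.pure fun _ => false
    | 1 => fun y _ => piPMF fun i => β (y i)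
    | i + 2 => fun y f =>
      P.bob i (subsequence y₀ (commonPositions n (f ⟨0, by omega⟩) (f ⟨1, by omega⟩)) y)
        fun j => f ⟨j + 2, by omega⟩
  -- With `κ` the key law of `P` under the new source, a failure changes neither the law of the key
  -- nor, being independent of the discussion, its secrecy.
  keyA x f := (commonPositions n (f ⟨0, by omega⟩) (f ⟨1, by omega⟩)).elim κ fun e =>
    P.keyA (x ∘ e) fun j => f ⟨j + 2, by omega⟩
  keyB y f := P.keyB (subsequence y₀ (commonPositions n (f ⟨0, by omega⟩) (f ⟨1, by omega⟩)) y)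
    fun j => f ⟨j + 2, by omega⟩

variable (P : Protocol X Y n) {N : ℕ} (α : X → PMF Bool) (β : Y → PMF Bool) (x₀ : Fin n → X)
  (y₀ : Fin n → Y) (κ : PMF P.Key)

/-- A transcript of the sifted protocol consists of the two announcements and a transcript
of `P`. -/
def siftedTranscript :
    ((Fin N → Bool) × (Fin N → Bool) × P.Transcript) ≃ (P.sifted N α β x₀ y₀ κ).Transcript :=
  ((Equiv.refl (Fin N → Bool)).prodCongr
    (Fin.consEquiv fun i : Fin (P.rounds + 1) => siftedMsg (Fin N → Bool) P.Msg (i + 1))).trans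
    (Fin.consEquiv fun i : Fin (P.rounds + 2) => siftedMsg (Fin N → Bool) P.Msg i)

/-- The weight of a source symbol together with the outcomes `s`, `t` of the tests. -/
def testWeight (p : PMF (X × Y × Z)) (x : X) (y : Y) (z : Z) (s t : Bool) : ℝ :=
  (p (x, y, z)).toReal * (α x s).toReal * (β y t).toReal

theorem law_sifted (p : PMF (X × Y × Z)) (x y z s t f) (kA kB : P.Key) :
    (P.sifted N α β x₀ y₀ κ).law p x y z (P.siftedTranscript α β x₀ y₀ κ (s, t, f)) kA kB =
      (∏ i, testWeight α β p (x i) (y i) (z i) (s i) (t i)) *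
        ((∏ i, P.msgProb (subsequence x₀ (commonPositions n s t) x)
          (subsequence y₀ (commonPositions n s t) y) f i) *
        (((commonPositions n s t).elim κ fun e => P.keyA (x ∘ e) f) kA).toReal *
        (P.keyB (subsequence y₀ (commonPositions n s t) y) f kB).toReal) := by
  let E := P.siftedTranscript α β x₀ y₀ κ (s, t, f)
  let S := P.sifted N α β x₀ y₀ κ
  have h0 : S.msgProb x y E ⟨0, by simp [S, sifted]⟩ = ∏ i, (α (x i) (s i)).toReal := by
    rw [msgProb, if_pos (by simp)]
    exact piPMF_toReal _ _
  have h1 : S.msgProb x y E ⟨1, by simp [S, sifted]⟩ = ∏ i, (β (y i) (t i)).toReal := by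
    rw [msgProb, if_neg (by simp)]
    exact piPMF_toReal _ _
  have h2 : ∀ i : Fin P.rounds, S.msgProb x y E ⟨i + 2, by simp [S, sifted]⟩ =
      P.msgProb (subsequence x₀ (commonPositions n s t) x)
        (subsequence y₀ (commonPositions n s t) y) f i := by
    intro i
    unfold msgProb
    -- Two announcements shift the rounds by an even number, so the turns of `P` are preserved.
    have : Even ((i : ℕ) + 2) ↔ Even (i : ℕ) := by simp [Nat.even_add]
    simp only [this]
    rfl
  have hp : ∏ i, S.msgProb x y E i = (∏ i, (α (x i) (s i)).toReal) *
      ((∏ i, (β (y i) (t i)).toReal) * ∏ i, P.msgProb (subsequence x₀ (commonPositions n s t) x)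
        (subsequence y₀ (commonPositions n s t) y) f i) := by
    rw [← h0, ← h1, ← Finset.prod_congr rfl fun i _ => h2 i]
    exact (Fin.prod_univ_succ (n := P.rounds + 1) _).trans
      (congrArg _ (Fin.prod_univ_succ (n := P.rounds) _))
  have hA : (S.keyA x E kA).toReal =
      (((commonPositions n s t).elim κ fun e => P.keyA (x ∘ e) f) kA).toReal := rfl
  have hB : (S.keyB y E kB).toReal =
      (P.keyB (subsequence y₀ (commonPositions n s t) y) f kB).toReal := rfl
  change (∏ i, (p (x i, y i, z i)).toReal) * (∏ i, S.msgProb x y E i) *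
    (S.keyA x E kA).toReal * (S.keyB y E kB).toReal = _
  rw [hp, hA, hB]
  simp only [testWeight, Finset.prod_mul_distrib]
  ring

end Protocol

/-- Summing over two sequences a product weight against a function of the coordinates in the range
of `e`. -/
theorem sum_sum_comp_mul_prod {ι κ S T : Type*} [Fintype ι] [Fintype κ] [Fintype S] [Fintype T]
    [DecidableEq ι] [DecidableEq κ] (e : κ ↪ ι) [Fintype {i // i ∉ Set.range e}]
    (F : (κ → S) → (κ → T) → ℝ) (w : ι → S → T → ℝ) :
    ∑ x : ι → S, ∑ y : ι → T, F (x ∘ e) (y ∘ e) * ∏ i, w i (x i) (y i) =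
      (∑ x : κ → S, ∑ y : κ → T, F x y * ∏ j, w (e j) (x j) (y j)) *
        ∏ i : {i // i ∉ Set.range e}, ∑ x, ∑ y, w i x y := by
  have h := sum_comp_mul_prod e (fun u : κ → S × T => F (fun j => (u j).1) (fun j => (u j).2))
    fun i u => w i u.1 u.2
  rw [← (Equiv.arrowProdEquivProdArrow ι (fun _ => S) (fun _ => T)).symm.sum_comp,
    ← (Equiv.arrowProdEquivProdArrow κ (fun _ => S) (fun _ => T)).symm.sum_comp,
    Fintype.sum_prod_type, Fintype.sum_prod_type] at h
  simp only [Fintype.sum_prod_type] at h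
  exact h

/-! ### Key law, secrecy, agreement and failure probability of the sifted protocol -/

namespace Protocol

variable {X Y Z : Type*} {n N : ℕ} [Fintype X] [Fintype Y] [Fintype Z]
  (P : Protocol X Y n) (α : X → PMF Bool) (β : Y → PMF Bool) (x₀ : Fin n → X)
  (y₀ : Fin n → Y) (κ : PMF P.Key) (p q : PMF (X × Y × Z)) (c : ℝ)

/-- The probability of the outcomes `s`, `t` of the two tests. -/
def testLaw (s t : Bool) : ℝ := ∑ z, ∑ x, ∑ y, testWeight α β p x y z s t

theorem testWeight_nonneg (x : X) (y : Y) (z : Z) (s t) : 0 ≤ testWeight α β p x y z s t := by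
  unfold testWeight
  positivity

theorem testLaw_nonneg (s t) : 0 ≤ testLaw α β p s t :=
  Finset.sum_nonneg fun _ _ => Finset.sum_nonneg fun _ _ => Finset.sum_nonneg fun _ _ =>
    testWeight_nonneg _ _ _ _ _ _ _ _

theorem sum_comm_last (f : X → Y → Z → ℝ) : ∑ z, ∑ x, ∑ y, f x y z = ∑ x, ∑ y, ∑ z, f x y z := by
  rw [Finset.sum_comm]
  exact Fintype.sum_congr _ _ fun x => Finset.sum_comm

theorem sum_comm_first {A B C D : Type*} [Fintype A] [Fintype B] [Fintype C] [Fintype D]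
    (g : A → B → C → D → ℝ) :
    ∑ a, ∑ b, ∑ c, ∑ d, g a b c d = ∑ b, ∑ c, ∑ d, ∑ a, g a b c d := by
  rw [Finset.sum_comm]
  refine Fintype.sum_congr _ _ fun b => ?_
  rw [Finset.sum_comm]
  exact Fintype.sum_congr _ _ fun c => Finset.sum_comm

theorem sum_testLaw : ∑ s, ∑ t, testLaw α β p s t = 1 := by
  have h : ∀ x y z, ∑ s, ∑ t, testWeight α β p x y z s t = (p (x, y, z)).toReal := fun x y z => by
    simp only [testWeight, ← Finset.mul_sum, sum_toReal_eq_one, mul_one]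
  rw [← sum_pmf_triple p, ← sum_comm_last]
  simp only [testLaw, ← h]
  simp only [Fintype.sum_bool, Finset.sum_add_distrib]

theorem testLaw_true_true
    (hq : ∀ x y z, testWeight α β p x y z true true = c * (q (x, y, z)).toReal) :
    testLaw α β p true true = c := by
  simp only [testLaw, hq, ← Finset.mul_sum]
  rw [sum_comm_last fun x y z => (q (x, y, z)).toReal, sum_pmf_triple, mul_one]

open Classical in
/-- The weight of Eve's symbols outside the positions `e`, for outcomes `s`, `t` of the tests. -/
def restWeight (e : Fin n ↪ Fin N) (s t : Fin N → Bool) (z : Fin N → Z) : ℝ :=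
  ∏ i : {i // i ∉ Set.range e}, ∑ x, ∑ y, testWeight α β p x y (z i) (s i) (t i)

/-- At the positions `e` both tests succeed, so each weight there is `c` times `q`. The other
positions are not seen by `G` and contribute only a factor in `z`. -/
theorem sum_testWeight_mul
    (hq : ∀ x y z, testWeight α β p x y z true true = c * (q (x, y, z)).toReal)
    {e : Fin n ↪ Fin N} {s t : Fin N → Bool} (he : commonPositions n s t = some e)
    (z : Fin N → Z) (G : (Fin n → X) → (Fin n → Y) → ℝ) :
    ∑ x : Fin N → X, ∑ y : Fin N → Y,
        (∏ i, testWeight α β p (x i) (y i) (z i) (s i) (t i)) * G (x ∘ e) (y ∘ e) =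
      c ^ n * restWeight α β p e s t z *
        ∑ x, ∑ y, (∏ j, (q (x j, y j, (z ∘ e) j)).toReal) * G x y := by
  classical
  have h := sum_sum_comp_mul_prod e G fun i x y => testWeight α β p x y (z i) (s i) (t i)
  have hs : ∀ j, s (e j) = true := fun j => (commonPositions_spec he j).1
  have ht : ∀ j, t (e j) = true := fun j => (commonPositions_spec he j).2
  simp only [hs, ht, hq, Finset.prod_mul_distrib, Finset.prod_const, Finset.card_univ,
    Fintype.card_fin] at h
  have h' : ∑ x, ∑ y, G x y * (c ^ n * ∏ j, (q (x j, y j, z (e j))).toReal) =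
      c ^ n * ∑ x, ∑ y, G x y * ∏ j, (q (x j, y j, z (e j))).toReal := by
    simp only [Finset.mul_sum, mul_left_comm]
  simp only [mul_comm _ (G _ _)]
  rw [h, h', restWeight]
  simp only [Function.comp_apply]
  ring

/-- Each position of `e` has test probability `c`, so `c ^ n` together with the summed weights of
the other positions is the probability of the outcomes `s`, `t`. -/
theorem sum_restWeight_mul
    (hq : ∀ x y z, testWeight α β p x y z true true = c * (q (x, y, z)).toReal)
    {e : Fin n ↪ Fin N} {s t : Fin N → Bool} (he : commonPositions n s t = some e)
    (F : (Fin n → Z) → ℝ) :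
    ∑ z, c ^ n * restWeight α β p e s t z * F (z ∘ e) =
      (∏ i, testLaw α β p (s i) (t i)) * ∑ z, F z := by
  classical
  -- Weight `1` on the range of `e` turns the product over the complement into one over all
  -- positions.
  let v : Fin N → Z → ℝ := fun i z =>
    if i ∈ Set.range e then 1 else ∑ x, ∑ y, testWeight α β p x y z (s i) (t i)
  have hv1 : ∀ j z, v (e j) z = 1 := fun j z => if_pos ⟨j, rfl⟩
  have hv2 : ∀ (i : {i // i ∉ Set.range e}) z,
      v i z = ∑ x, ∑ y, testWeight α β p x y z (s i) (t i) := fun i z => if_neg i.2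
  have h := sum_comp_mul_prod e F v
  have hr : ∀ z, ∏ i, v i (z i) = restWeight α β p e s t z := fun z => by
    rw [prod_eq_prod_mul_prod_compl_range e]
    simp only [hv1, hv2, Finset.prod_const_one, one_mul]
    rfl
  have hl : ∏ i, testLaw α β p (s i) (t i) = c ^ n * ∏ i : {i // i ∉ Set.range e}, ∑ a, v i a := by
    rw [prod_eq_prod_mul_prod_compl_range e]
    simp only [(commonPositions_spec he _).1, (commonPositions_spec he _).2,
      testLaw_true_true α β p q c hq, Finset.prod_const, Finset.card_univ, Fintype.card_fin, hv2]
    rfl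
  simp only [hr, hv1, Finset.prod_const_one, mul_one] at h
  rw [hl, mul_assoc, mul_comm _ (∑ z, F z), ← h, Finset.mul_sum]
  exact Fintype.sum_congr _ _ fun z => by ring

/-- Eve's symbols outside `e` say nothing about the key: each column is a multiple, not depending on
the key, of a column for `P` under `q`. -/
theorem keyEveLaw_sifted_of_some
    (hq : ∀ x y z, testWeight α β p x y z true true = c * (q (x, y, z)).toReal)
    {e : Fin n ↪ Fin N} {s t : Fin N → Bool} (he : commonPositions n s t = some e) (z f)
    (k : P.Key) :
    (P.sifted N α β x₀ y₀ κ).keyEveLaw p (k, z, P.siftedTranscript α β x₀ y₀ κ (s, t, f)) =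
      c ^ n * restWeight α β p e s t z * P.keyEveLaw q (k, z ∘ e, f) := by
  have h := sum_testWeight_mul α β p q c hq he z fun x y => ∑ kB,
    (∏ i, P.msgProb x y f i) * (P.keyA x f k).toReal * (P.keyB y f kB).toReal
  simp only [Finset.mul_sum] at h
  calc _ = _ := Fintype.sum_congr _ _ fun x => Fintype.sum_congr _ _ fun y =>
        Fintype.sum_congr _ _ fun kB => by
          rw [law_sifted, he]
          rfl
    _ = _ := h
    _ = _ := by
      simp only [keyEveLaw, Finset.mul_sum, law, mul_assoc]

theorem keyEveLaw_sifted_of_none {s t : Fin N → Bool}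
    (he : commonPositions n s t = none) (z f) (k : P.Key) :
    (P.sifted N α β x₀ y₀ κ).keyEveLaw p (k, z, P.siftedTranscript α β x₀ y₀ κ (s, t, f)) =
      ((∑ x : Fin N → X, ∑ y : Fin N → Y,
        ∏ i, testWeight α β p (x i) (y i) (z i) (s i) (t i)) * ∏ i, P.msgProb x₀ y₀ f i) *
        (κ k).toReal := by
  calc _ = ∑ x : Fin N → X, ∑ y : Fin N → Y, ∑ kB,
        (∏ i, testWeight α β p (x i) (y i) (z i) (s i) (t i)) *
          ((∏ i, P.msgProb x₀ y₀ f i) * (κ k).toReal * (P.keyB y₀ f kB).toReal) :=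
        Fintype.sum_congr _ _ fun x => Fintype.sum_congr _ _ fun y =>
        Fintype.sum_congr _ _ fun kB => by
          rw [law_sifted, he]
          rfl
    _ = _ := by
      simp only [← Finset.mul_sum, sum_toReal_eq_one, mul_one, ← Finset.sum_mul, mul_assoc]

/-- Summing a homogeneous functional of the law of Alice's key over Eve's views, when the tests
leave enough symbols. -/
theorem sum_view_of_some
    (hq : ∀ x y z, testWeight α β p x y z true true = c * (q (x, y, z)).toReal)
    {e : Fin n ↪ Fin N} {s t : Fin N → Bool} (he : commonPositions n s t = some e)
    (L : (P.Key → ℝ) → ℝ) (hL : ∀ a v, L (fun k => a * v k) = a * L v) :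
    ∑ z, ∑ f, L (fun k => (P.sifted N α β x₀ y₀ κ).keyEveLaw p
        (k, z, P.siftedTranscript α β x₀ y₀ κ (s, t, f))) =
      (∏ i, testLaw α β p (s i) (t i)) * ∑ o, L (fun k => P.keyEveLaw q (k, o)) := by
  have h : ∀ z f, L (fun k => (P.sifted N α β x₀ y₀ κ).keyEveLaw p
      (k, z, P.siftedTranscript α β x₀ y₀ κ (s, t, f))) =
      c ^ n * restWeight α β p e s t z * L (fun k => P.keyEveLaw q (k, z ∘ e, f)) := by
    intro z f
    rw [← hL]
    congr 1
    funext k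
    exact P.keyEveLaw_sifted_of_some α β x₀ y₀ κ p q c hq he z f k
  simp only [h, ← Finset.mul_sum]
  rw [sum_restWeight_mul α β p q c hq he fun z => ∑ f, L (fun k => P.keyEveLaw q (k, z, f)),
    Fintype.sum_prod_type]

/-- Summing a homogeneous functional of the law of Alice's key over Eve's views, when the tests
do not leave enough symbols. -/
theorem sum_view_of_none {s t : Fin N → Bool} (he : commonPositions n s t = none)
    (L : (P.Key → ℝ) → ℝ) (hL : ∀ a v, L (fun k => a * v k) = a * L v) :
    ∑ z, ∑ f, L (fun k => (P.sifted N α β x₀ y₀ κ).keyEveLaw p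
        (k, z, P.siftedTranscript α β x₀ y₀ κ (s, t, f))) =
      (∏ i, testLaw α β p (s i) (t i)) * L (fun k => (κ k).toReal) := by
  have h : ∀ z f, L (fun k => (P.sifted N α β x₀ y₀ κ).keyEveLaw p
      (k, z, P.siftedTranscript α β x₀ y₀ κ (s, t, f))) =
      ((∑ x : Fin N → X, ∑ y : Fin N → Y,
        ∏ i, testWeight α β p (x i) (y i) (z i) (s i) (t i)) * ∏ i, P.msgProb x₀ y₀ f i) *
        L (fun k => (κ k).toReal) := by
    intro z f
    rw [← hL]
    congr 1
    funext k
    exact P.keyEveLaw_sifted_of_none α β x₀ y₀ κ p he z f k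
  simp only [h, ← Finset.sum_mul, ← Finset.mul_sum, sum_prod_msgProb, mul_one]
  rw [sum_triple fun i z x y => testWeight α β p x y z (s i) (t i)]
  rfl

theorem sum_sifted_transcript (Φ : (P.sifted N α β x₀ y₀ κ).Transcript → ℝ) :
    ∑ f, Φ f = ∑ s, ∑ t, ∑ f, Φ (P.siftedTranscript α β x₀ y₀ κ (s, t, f)) := by
  rw [← (P.siftedTranscript α β x₀ y₀ κ).sum_comp]
  simp only [Fintype.sum_prod_type]

theorem sum_sifted_view (Φ : (Fin N → Z) × (P.sifted N α β x₀ y₀ κ).Transcript → ℝ) :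
    ∑ o, Φ o = ∑ s, ∑ t, ∑ z, ∑ f, Φ (z, P.siftedTranscript α β x₀ y₀ κ (s, t, f)) := by
  rw [Fintype.sum_prod_type]
  simp only [sum_sifted_transcript]
  rw [Finset.sum_comm]
  exact Fintype.sum_congr _ _ fun s => Finset.sum_comm

theorem sum_prod_testLaw :
    ∑ s : Fin N → Bool, ∑ t : Fin N → Bool, ∏ i, testLaw α β p (s i) (t i) = 1 := by
  have h : ∀ s : Fin N → Bool, ∑ t : Fin N → Bool, ∏ i, testLaw α β p (s i) (t i) =
      ∏ i, ∑ t, testLaw α β p (s i) t := fun s => sum_prod_pi fun i t => testLaw α β p (s i) t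
  simp only [h]
  rw [sum_prod_pi fun (_ : Fin N) s => ∑ t, testLaw α β p s t]
  simp only [sum_testLaw, Finset.prod_const_one]

/-- The probability that the tests leave `n` of `N` symbols. -/
def successProb (n N : ℕ) : ℝ :=
  ∑ s : Fin N → Bool, ∑ t : Fin N → Bool,
    if (commonPositions n s t).isSome then ∏ i, testLaw α β p (s i) (t i) else 0

theorem prod_testLaw_nonneg (s t : Fin N → Bool) : 0 ≤ ∏ i, testLaw α β p (s i) (t i) :=
  Finset.prod_nonneg fun _ _ => testLaw_nonneg _ _ _ _ _

theorem successProb_le_one : successProb α β p n N ≤ 1 := by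
  rw [← sum_prod_testLaw (N := N) α β p]
  refine Finset.sum_le_sum fun s _ => Finset.sum_le_sum fun t _ => ?_
  split_ifs
  · exact le_rfl
  · exact prod_testLaw_nonneg α β p s t

theorem successProb_nonneg : 0 ≤ successProb α β p n N := by
  refine Finset.sum_nonneg fun s _ => Finset.sum_nonneg fun t _ => ?_
  split_ifs
  · exact prod_testLaw_nonneg α β p s t
  · exact le_rfl

/-- For each pair of test outcomes, successful or not, the key has the same conditional law by the
choice of `κ`. Evaluation at `k` is the homogeneous functional used here. -/
theorem keyLaw_sifted
    (hq : ∀ x y z, testWeight α β p x y z true true = c * (q (x, y, z)).toReal)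
    (hκ : ∀ k, (κ k).toReal = P.keyLaw q k) :
    (P.sifted N α β x₀ y₀ κ).keyLaw p = P.keyLaw q := by
  funext (k : P.Key)
  have h : ∀ s t : Fin N → Bool, ∑ z, ∑ f, (P.sifted N α β x₀ y₀ κ).keyEveLaw p
      (k, z, P.siftedTranscript α β x₀ y₀ κ (s, t, f)) =
      (∏ i, testLaw α β p (s i) (t i)) * P.keyLaw q k := fun s t => by
    rcases he : commonPositions n s t with _ | e
    · rw [← hκ]
      exact P.sum_view_of_none α β x₀ y₀ κ p he (fun v => v k) fun a v => rfl
    · rw [← sum_keyEveLaw]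
      exact P.sum_view_of_some α β x₀ y₀ κ p q c hq he (fun v => v k) fun a v => rfl
  refine ((sum_keyEveLaw (P.sifted N α β x₀ y₀ κ) p k).symm.trans
    (P.sum_sifted_view α β x₀ y₀ κ _)).trans ?_
  simp only [h, ← Finset.sum_mul, sum_prod_testLaw, one_mul]

/-- Conditional entropy averages over the test outcomes: success gives its value for `P` under `q`,
and failure gives the full entropy of the key, which is then independent of Eve's view. -/
theorem mutualInfo_sifted
    (hq : ∀ x y z, testWeight α β p x y z true true = c * (q (x, y, z)).toReal)
    (hκ : ∀ k, (κ k).toReal = P.keyLaw q k) :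
    mutualInfo ((P.sifted N α β x₀ y₀ κ).keyEveLaw p) =
      successProb α β p n N * mutualInfo (P.keyEveLaw q) := by
  have h : ∀ s t : Fin N → Bool, ∑ z, ∑ f, columnEntropy (fun k : P.Key =>
      (P.sifted N α β x₀ y₀ κ).keyEveLaw p
        (k, z, P.siftedTranscript α β x₀ y₀ κ (s, t, f))) =
      (∏ i, testLaw α β p (s i) (t i)) * entropy (P.keyLaw q) -
        (if (commonPositions n s t).isSome then ∏ i, testLaw α β p (s i) (t i) else 0) *
          mutualInfo (P.keyEveLaw q) := fun s t => by
    rcases he : commonPositions n s t with _ | e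
    · rw [P.sum_view_of_none α β x₀ y₀ κ p he _ columnEntropy_mul]
      simp only [hκ, Option.isSome_none]
      rw [columnEntropy_eq_entropy _ (P.sum_keyLaw q)]
      simp
    · rw [P.sum_view_of_some α β x₀ y₀ κ p q c hq he _ columnEntropy_mul, mutualInfo_eq_sub]
      simp only [sum_keyEveLaw, Option.isSome_some, if_true]
      ring
  rw [mutualInfo_eq_sub, sum_sifted_view]
  simp only [sum_keyEveLaw]
  rw [keyLaw_sifted P α β x₀ y₀ κ p q c hq hκ]
  have h' := Fintype.sum_congr _ _ fun s => Fintype.sum_congr _ _ fun t => h s t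
  simp only [Finset.sum_sub_distrib, ← Finset.sum_mul, sum_prod_testLaw, one_mul] at h'
  rw [successProb]
  refine (congrArg (entropy (P.keyLaw q) - ·) h').trans ?_
  ring

/-- On success the agreement probability is that of `P` under `q`; agreement on failure is
discarded. -/
theorem successProb_mul_agreeProb_le
    (hq : ∀ x y z, testWeight α β p x y z true true = c * (q (x, y, z)).toReal) :
    successProb α β p n N * P.agreeProb q ≤ (P.sifted N α β x₀ y₀ κ).agreeProb p := by
  let S := P.sifted N α β x₀ y₀ κ
  have h : ∀ s t : Fin N → Bool,
      (if (commonPositions n s t).isSome then ∏ i, testLaw α β p (s i) (t i) else 0) *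
        P.agreeProb q ≤ ∑ z, ∑ x, ∑ y, ∑ f, ∑ k,
          S.law p x y z (P.siftedTranscript α β x₀ y₀ κ (s, t, f)) k k := fun s t => by
    rcases he : commonPositions n s t with _ | e
    · simp only [Option.isSome_none, Bool.false_eq_true, if_false, zero_mul]
      exact Finset.sum_nonneg fun z _ => Finset.sum_nonneg fun x _ => Finset.sum_nonneg fun y _ =>
        Finset.sum_nonneg fun f _ => Finset.sum_nonneg fun k _ => S.law_nonneg p x y z _ k k
    · simp only [Option.isSome_some, if_true]
      refine le_of_eq (Eq.symm ?_)
      have h1 := fun z => sum_testWeight_mul α β p q c hq he z fun x y => ∑ f, ∑ k,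
        (∏ i, P.msgProb x y f i) * (P.keyA x f k).toReal * (P.keyB y f k).toReal
      calc _ = ∑ z : Fin N → Z, ∑ x : Fin N → X, ∑ y : Fin N → Y,
            (∏ i, testWeight α β p (x i) (y i) (z i) (s i) (t i)) *
              ∑ f, ∑ k, (∏ i, P.msgProb (x ∘ e) (y ∘ e) f i) * (P.keyA (x ∘ e) f k).toReal *
                (P.keyB (y ∘ e) f k).toReal := by
              refine Fintype.sum_congr _ _ fun z => Fintype.sum_congr _ _ fun x =>
                Fintype.sum_congr _ _ fun y => ?_
              simp only [Finset.mul_sum]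
              refine Fintype.sum_congr _ _ fun f => Fintype.sum_congr _ _ fun k => ?_
              refine (P.law_sifted α β x₀ y₀ κ p x y z s t f k k).trans ?_
              rw [he]
              rfl
        _ = _ := by
            simp only [h1]
            rw [sum_restWeight_mul α β p q c hq he fun z => ∑ x : Fin n → X, ∑ y : Fin n → Y,
              (∏ j, (q (x j, y j, z j)).toReal) * ∑ f, ∑ k,
                (∏ i, P.msgProb x y f i) * (P.keyA x f k).toReal * (P.keyB y f k).toReal,
              sum_comm_last]
            simp only [Finset.mul_sum, agreeProb, law, mul_assoc]
  calc successProb α β p n N * P.agreeProb q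
      ≤ ∑ s, ∑ t, ∑ z, ∑ x, ∑ y, ∑ f, ∑ k,
          S.law p x y z (P.siftedTranscript α β x₀ y₀ κ (s, t, f)) k k := by
        simp only [successProb, Finset.sum_mul]
        exact Finset.sum_le_sum fun s _ => Finset.sum_le_sum fun t _ => h s t
    _ = S.agreeProb p := by
        rw [Fintype.sum_congr _ _ fun s => sum_comm_first _, sum_comm_first, sum_comm_last]
        refine Fintype.sum_congr _ _ fun x => Fintype.sum_congr _ _ fun y =>
          Fintype.sum_congr _ _ fun z => ?_
        exact (P.sum_sifted_transcript α β x₀ y₀ κ fun f => ∑ k, S.law p x y z f k k).symm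

/-- A Chernoff bound: failure means that fewer than `n` symbols are kept by both, so its indicator
is at most `2 ^ n * (1 / 2) ^ count`, and each symbol contributes the mean `1 - c / 2`. -/
theorem one_sub_successProb_le (hc : testLaw α β p true true = c) :
    1 - successProb α β p n N ≤ 2 ^ n * (1 - c / 2) ^ N := by
  let θ : Bool → Bool → ℝ := fun s t => if s = true ∧ t = true then 1 / 2 else 1
  have hθ : ∀ s t, 0 ≤ θ s t := fun s t => by simp only [θ]; split_ifs <;> norm_num
  have hsum : ∑ s, ∑ t, θ s t * testLaw α β p s t = 1 - c / 2 := by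
    have := sum_testLaw α β p
    simp only [Fintype.sum_bool, hc] at this ⊢
    simp only [θ]
    norm_num
    linarith
  have h1 : ∀ s t : Fin N → Bool, (∏ i, testLaw α β p (s i) (t i)) -
      (if (commonPositions n s t).isSome then ∏ i, testLaw α β p (s i) (t i) else 0) ≤
        2 ^ n * ∏ i, θ (s i) (t i) * testLaw α β p (s i) (t i) := fun s t => by
    have h0 := prod_testLaw_nonneg α β p s t
    rw [Finset.prod_mul_distrib]
    have hθ' : 0 ≤ ∏ i, θ (s i) (t i) := Finset.prod_nonneg fun i _ => hθ _ _
    rcases he : commonPositions n s t with _ | e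
    · have hcard := card_lt_of_commonPositions_eq_none he
      have : ∏ i, θ (s i) (t i) =
          (1 / 2) ^ (Finset.univ.filter fun i => s i = true ∧ t i = true).card := by
        simp only [θ]
        rw [Finset.prod_ite]
        simp
      have h2 : (1 / 2 : ℝ) ^ n ≤ ∏ i, θ (s i) (t i) := by
        rw [this]
        exact pow_le_pow_of_le_one (by norm_num) (by norm_num) hcard.le
      have h3 : 1 ≤ 2 ^ n * ∏ i, θ (s i) (t i) := by
        calc (1 : ℝ) = 2 ^ n * (1 / 2) ^ n := by rw [← mul_pow]; norm_num
          _ ≤ _ := by gcongr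
      simp only [Option.isSome_none, Bool.false_eq_true, if_false, sub_zero]
      rw [← mul_assoc]
      exact le_mul_of_one_le_left h0 h3
    · simp only [Option.isSome_some, if_true, sub_self]
      exact mul_nonneg (by positivity) (mul_nonneg hθ' h0)
  have h4 : ∀ s : Fin N → Bool, ∑ t : Fin N → Bool, ∏ i, θ (s i) (t i) * testLaw α β p (s i) (t i) =
      ∏ i, ∑ t, θ (s i) t * testLaw α β p (s i) t :=
    fun s => sum_prod_pi fun i t => θ (s i) t * testLaw α β p (s i) t
  calc 1 - successProb α β p n N
      = ∑ s : Fin N → Bool, ∑ t : Fin N → Bool, ((∏ i, testLaw α β p (s i) (t i)) -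
      (if (commonPositions n s t).isSome then ∏ i, testLaw α β p (s i) (t i) else 0)) := by
        simp only [Finset.sum_sub_distrib, sum_prod_testLaw]
        rfl
    _ ≤ ∑ s : Fin N → Bool, ∑ t : Fin N → Bool,
          2 ^ n * ∏ i, θ (s i) (t i) * testLaw α β p (s i) (t i) :=
        Finset.sum_le_sum fun s _ => Finset.sum_le_sum fun t _ => h1 s t
    _ = 2 ^ n * (1 - c / 2) ^ N := by
        simp only [← Finset.mul_sum, h4]
        rw [sum_prod_pi fun (_ : Fin N) s => ∑ t, θ s t * testLaw α β p s t]
        simp only [hsum, Finset.prod_const, Finset.card_univ, Fintype.card_fin]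

end Protocol

/-! ### Existence of the tests and choice of the parameters -/

theorem source_apply {X Y Z : Type*} (p : PMF (X × Y)) (W : X × Y → PMF Z) (x : X) (y : Y)
    (z : Z) : source p W (x, y, z) = p (x, y) * W (x, y) z := by
  classical
  rw [source, PMF.bind_apply, tsum_eq_single (x, y)]
  · congr 1
    rw [PMF.map_apply, tsum_eq_single z]
    · simp
    · intro z' hz
      simp [hz.symm]
  · rintro ⟨x', y'⟩ h
    rw [PMF.map_apply, ENNReal.tsum_eq_zero.2, mul_zero]
    intro z'
    rw [if_neg]
    rintro h'
    simp only [Prod.mk.injEq] at h'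
    exact h (Prod.ext h'.1.symm h'.2.1.symm)

/-- A test that accepts with probability proportional to a given function. -/
theorem exists_test {X : Type*} [Fintype X] (a : X → ℝ≥0) :
    ∃ (c : ℝ) (α : X → PMF Bool), 0 < c ∧ ∀ x, (α x true).toReal = c * a x := by
  -- The sum dominates every `a x`; the added `1` keeps `A` positive when `a` vanishes.
  let A : ℝ≥0 := 1 + ∑ x, a x
  have hA : 0 < A := by positivity
  have h : ∀ x, a x / A ≤ 1 := fun x => by
    refine (div_le_one hA).2 (le_add_left ?_)
    exact Finset.single_le_sum (fun _ _ => zero_le) (Finset.mem_univ x)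
  refine ⟨(A : ℝ)⁻¹, fun x => PMF.ofFintype
    (fun s => if s = true then ((a x / A : ℝ≥0) : ℝ≥0∞) else ((1 - a x / A : ℝ≥0) : ℝ≥0∞)) ?_,
    by positivity, fun x => ?_⟩
  · simp only [Fintype.sum_bool, Bool.false_eq_true, if_true, if_false]
    rw [← ENNReal.coe_add, add_tsub_cancel_of_le (h x), ENNReal.coe_one]
  · simp [PMF.ofFintype_apply, div_eq_inv_mul]

/-- The channel depends on `(x, y)` alone, so the factors `a x * b y` carry over from the pairs to
the triples. -/
theorem exists_tests {X Y Z : Type*} [Fintype X] [Fintype Y] (p q : PMF (X × Y))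
    (hqp : Preceq q p) (W : X × Y → PMF Z) :
    ∃ (c : ℝ) (α : X → PMF Bool) (β : Y → PMF Bool), 0 < c ∧ ∀ x y z,
      Protocol.testWeight α β (source p W) x y z true true =
        c * (source q W (x, y, z)).toReal := by
  obtain ⟨a, b, hab⟩ := hqp
  obtain ⟨c, α, hc, hα⟩ := exists_test a
  obtain ⟨d, β, hd, hβ⟩ := exists_test b
  refine ⟨c * d, α, β, mul_pos hc hd, fun x y z => ?_⟩
  simp only [Protocol.testWeight, source_apply, hab, hα, hβ, ENNReal.toReal_mul,
    ENNReal.coe_toReal]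
  ring

namespace Protocol

variable {X Y Z : Type*} {n : ℕ} [Fintype X] [Fintype Y] [Fintype Z]

/-- The law of Alice's key as a `PMF`. -/
def keyPMF (P : Protocol X Y n) (p : PMF (X × Y × Z)) : PMF P.Key :=
  PMF.ofFintype (fun k => ENNReal.ofReal (P.keyLaw p k)) <| by
    rw [← ENNReal.ofReal_sum_of_nonneg fun k _ => P.keyLaw_nonneg p k, sum_keyLaw,
      ENNReal.ofReal_one]

theorem keyPMF_toReal (P : Protocol X Y n) (p : PMF (X × Y × Z)) (k : P.Key) :
    (P.keyPMF p k).toReal = P.keyLaw p k :=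
  ENNReal.toReal_ofReal (P.keyLaw_nonneg p k)

theorem one_sub_mul_le_agreeProb_parallel (P : Protocol X Y n) (p : PMF (X × Y × Z)) (m : ℕ)
    {δ : ℝ} (h : 1 - δ ≤ P.agreeProb p) : 1 - m * δ ≤ (P.parallel m).agreeProb p := by
  rw [agreeProb_parallel]
  have h0 := P.agreeProb_nonneg p
  -- Bernoulli's inequality.
  have h1 := one_add_mul_le_pow (a := P.agreeProb p - 1) (by linarith) m
  rw [add_sub_cancel] at h1
  have : (m : ℝ) * (1 - P.agreeProb p) ≤ m * δ := by gcongr; linarith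
  linarith

end Protocol

/-- The factor `C` must serve all `δ` at once, since the rate is fixed before `δ`; it depends on `c`
alone. The number `M` of copies absorbs the dependence on `δ`. -/
theorem isAchievable_of_tests {X Y Z : Type*} [Fintype X] [Fintype Y] [Fintype Z]
    (p q : PMF (X × Y × Z)) (α : X → PMF Bool) (β : Y → PMF Bool) (c : ℝ) (hc : 0 < c)
    (hq : ∀ x y z, Protocol.testWeight α β p x y z true true = c * (q (x, y, z)).toReal) :
    ∃ C : ℕ, 0 < C ∧ ∀ R, IsAchievable q R → IsAchievable p (R / C) := by
  have hc' := Protocol.testLaw_true_true α β p q c hq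
  have hc1 : c ≤ 1 := by
    have h := Protocol.sum_testLaw α β p
    simp only [Fintype.sum_bool, hc'] at h
    linarith [Protocol.testLaw_nonneg α β p true false, Protocol.testLaw_nonneg α β p false true,
      Protocol.testLaw_nonneg α β p false false]
  -- With `1 / 4`, the Chernoff bound for `C` source symbols per needed symbol becomes a power of `2
  -- * (1 / 4) = 1 / 2`.
  obtain ⟨C, hC⟩ := exists_pow_lt_of_lt_one (show (0 : ℝ) < 1 / 4 by norm_num)
    (show 1 - c / 2 < 1 by linarith)
  have hC0 : 0 < C := Nat.pos_of_ne_zero fun h => by norm_num [h] at hC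
  refine ⟨C, hC0, fun R hR δ hδ => ?_⟩
  obtain ⟨m, hm⟩ := exists_pow_lt_of_lt_one (half_pos hδ) (show (1 / 2 : ℝ) < 1 by norm_num)
  have hm0 : 0 < m + 1 := m.succ_pos
  set M := m + 1 with hM
  have hMR : (0 : ℝ) < M := by exact_mod_cast hm0
  have hM1 : (1 : ℝ) ≤ M := by exact_mod_cast hm0
  have hCR : (0 : ℝ) < C := by exact_mod_cast hC0
  have hC1 : (1 : ℝ) ≤ C := by exact_mod_cast hC0
  -- Disagreement grows at most by the factor `M` under repetition; the other half of `δ` is for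
  -- failure of the sifting.
  obtain ⟨n, hn, P, hP, hrate⟩ := hR (δ / 2 / M) (by positivity)
  have hnR : (0 : ℝ) < n := by exact_mod_cast hn
  -- The fallback observations are arbitrary; the support of `q` shows that the alphabets are
  -- nonempty.
  obtain ⟨⟨x', y', -⟩, -⟩ := q.support_nonempty
  let Q := P.parallel M
  let S := Q.sifted (C * (M * n)) α β (fun _ => x') (fun _ => y') (Q.keyPMF q)
  have hkey : S.keyLaw p = Q.keyLaw q :=
    Q.keyLaw_sifted α β _ _ _ p q c hq (Q.keyPMF_toReal q)
  have hH : entropy (S.keyLaw p) = M * entropy (P.keyLaw q) :=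
    (congrArg (entropy (α := Q.Key)) hkey).trans (P.entropy_keyLaw_parallel q M)
  have hI : mutualInfo (S.keyEveLaw p) =
      Protocol.successProb α β p (M * n) (C * (M * n)) * (M * mutualInfo (P.keyEveLaw q)) :=
    (Q.mutualInfo_sifted α β _ _ _ p q c hq (Q.keyPMF_toReal q)).trans
      (congrArg _ (P.mutualInfo_parallel q M))
  have hcard : Real.log (Fintype.card S.Key) = M * Real.log (Fintype.card P.Key) := by
    have : Fintype.card S.Key = Fintype.card P.Key ^ M :=
      (Fintype.card_fun (α := Fin M) (β := P.Key)).trans (by rw [Fintype.card_fin])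
    rw [this]
    push_cast
    exact Real.log_pow _ _
  have hscale : ∀ t : ℝ, 1 / ((C * (M * n) : ℕ) : ℝ) * (M * t) = 1 / (n : ℝ) * t / C := fun t => by
    push_cast
    field_simp
  have hδ' : δ / 2 / M / C ≤ δ := by
    rw [div_div, div_div]
    refine div_le_self hδ.le ?_
    nlinarith [mul_le_mul hM1 hC1 zero_le_one hMR.le]
  set σ := Protocol.successProb α β p (M * n) (C * (M * n))
  have hσ0 : 0 ≤ σ := Protocol.successProb_nonneg α β p
  have hσ1 : σ ≤ 1 := Protocol.successProb_le_one α β p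
  have hfail : 1 - σ ≤ δ / 2 := by
    calc 1 - σ ≤ 2 ^ (M * n) * (1 - c / 2) ^ (C * (M * n)) :=
          Protocol.one_sub_successProb_le α β p c hc'
      _ = (2 * (1 - c / 2) ^ C) ^ (M * n) := by rw [mul_pow, pow_mul (1 - c / 2) C]
      _ ≤ (1 / 2) ^ (M * n) := by
          have : 0 ≤ (1 - c / 2) ^ C := pow_nonneg (by linarith) _
          gcongr
          linarith
      _ ≤ (1 / 2) ^ m := by
          refine pow_le_pow_of_le_one (by norm_num) (by norm_num) ?_
          nlinarith
      _ ≤ δ / 2 := hm.le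
  refine ⟨C * (M * n), by positivity, S, ⟨?_, ?_, ?_⟩, ?_⟩
  · have h1 : 1 - δ / 2 ≤ Q.agreeProb q := by
      have := P.one_sub_mul_le_agreeProb_parallel q M hP.agree
      rwa [mul_div_cancel₀ _ hMR.ne'] at this
    have h2 : σ * Q.agreeProb q ≤ S.agreeProb p :=
      Q.successProb_mul_agreeProb_le α β _ _ _ p q c hq
    -- Here `σ * (1 - δ / 2) ≥ σ - δ / 2 ≥ 1 - δ`.
    nlinarith [mul_le_mul_of_nonneg_left h1 hσ0]
  · rw [hcard, hH, hscale, hscale]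
    have := div_le_div_of_nonneg_right hP.uniform hCR.le
    rw [sub_div] at this
    linarith
  · rw [hI, mul_left_comm, hscale]
    have h1 := div_le_div_of_nonneg_right hP.secret hCR.le
    -- Bounding the information before dropping `σ` makes nonnegativity of mutual information
    -- unnecessary.
    calc σ * (1 / (n : ℝ) * mutualInfo (P.keyEveLaw q) / C) ≤ σ * (δ / 2 / M / C) := by gcongr
      _ ≤ δ / 2 / M / C := mul_le_of_le_one_left (by positivity) hσ1
      _ ≤ δ := hδ'
  · rw [hH, hscale, hrate]

end SKAgreement

end

theorem theorem3 {X Y Z : Type*} [Fintype X] [Fintype Y] [Fintype Z]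
    (p q : PMF (X × Y)) (hqp : SKAgreement.Preceq q p) (W : X × Y → PMF Z)
    (hq : 0 < SKAgreement.skCapacity (SKAgreement.source q W)) :
    0 < SKAgreement.skCapacity (SKAgreement.source p W) := by
  obtain ⟨c, α, β, hc, h⟩ := SKAgreement.exists_tests p q hqp W
  obtain ⟨C, hC, hach⟩ := SKAgreement.isAchievable_of_tests _ _ α β c hc h
  simp only [SKAgreement.skCapacity, lt_iSup_iff] at hq ⊢
  obtain ⟨R, hR, hpos⟩ := hq
  have hpos' : 0 < R := by exact_mod_cast hpos
  have : 0 < R / C := div_pos hpos' (by exact_mod_cast hC)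
  exact ⟨R / C, hach R hR, by exact_mod_cast this⟩
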